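/- Let $q$ be an indeterminate. For $m\ge 0$ put $[m]_q=1+q+\cdots+q^{m-1}$ (so $[0]_q=0$), $[m]_q!=[1]_q[2]_q\cdots[m]_q$, and for $0\le j\le m$ put ${m\brack j}_q=\frac{[m]_q!}{[j]_q!\,[m-j]_q!}$; replacing $q$ by $q^2$ gives $[m]_{q^2}!$ and ${m\brack j}_{q^2}$. The type B $q$-Stirling numbers of the second kind $S_B[n,k]$ are defined by $$S_B[n,k]=S_B[n-1,k-1]+[2k+1]_q\,S_B[n-1,k]\quad(n\ge 1,\ k\ge 0),\qquad S_B[0,k]=\delta_{0k},\qquad S_B[n,-1]=0.$$ Let $\mathcal B_n$ be the group of signed permutations of $[n]=\{1,\dots,n\}$, i.e. permutations $\pi$ of $\{-n,\dots,-1,1,\dots,n\}$ with $\pi(-i)=-\pi(i)$; write $\pi_i=\pi(i)$ and $\pi_0=0$. Let $\mathrm{Des}_B(\pi)=\{i\in\{0,1,\dots,n-1\}:\pi_i>\pi_{i+1}\}$, $\mathrm{des}_B(\pi)=|\mathrm{Des}_B(\pi)|$, $\mathrm{neg}(\pi)=|\{i\in[n]:\pi_i<0\}|$, $\mathrm{fmaj}(\pi)=\sum_{i\in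 \mathrm{Des}_B(\pi)}2i+\mathrm{neg}(\pi)$, and $$B_{n,\ell}(q)=\sum_{\pi\in\mathcal B_n,\ \mathrm{des}_B(\pi)=\ell}q^{\mathrm{fmaj}(\pi)}.$$ Then for all integers $0\le k\le n$, $$[2]_q^{\,k}\,[k]_{q^2}!\,S_B[n,k]=\sum_{\ell=0}^{k}q^{k(k-2\ell)}\,B_{n,\ell}(q)\,{n-\ell\brack k-\ell}_{q^2}$$ as an identity of rational functions in $q$ over $\mathbb{Q}$. -/

import Mathlib

/-- The set `[±n] = {-n, …, -1, 1, …, n}` of integers. -/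
noncomputable def pmSet (n : ℕ) : Finset ℤ := (Finset.Icc (-(n : ℤ)) (n : ℤ)).erase 0

/-- The signed permutations of `[n]` (the hyperoctahedral group `𝓑ₙ`): the permutations `π` of
`[±n]` such that `π(-i) = -π(i)` for all `i`. -/
abbrev SignedPerm (n : ℕ) : Type :=
  {π : Equiv.Perm (pmSet n) // ∀ i j : pmSet n, (j : ℤ) = -(i : ℤ) → (π j : ℤ) = -(π i : ℤ)}

namespace SignedPerm

/-- The letter `π_i = π(i)` for `1 ≤ i ≤ n`, and `π_0 = 0` (positions `i > n` are never used). -/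
noncomputable def letter {n : ℕ} (π : SignedPerm n) (i : ℕ) : ℤ :=
  if h : (i : ℤ) ∈ pmSet n then (π.1 ⟨(i : ℤ), h⟩ : ℤ) else 0

/-- The type B descent set `{i ∈ {0, 1, …, n - 1} : π_i > π_{i+1}}`, where `π_0 = 0`. -/
noncomputable def desSetB {n : ℕ} (π : SignedPerm n) : Finset ℕ :=
  (Finset.range n).filter fun i => π.letter (i + 1) < π.letter i

/-- The number of type B descents. -/
noncomputable def desB {n : ℕ} (π : SignedPerm n) : ℕ := π.desSetB.card

/-- The number of negative letters among `π_1, …, π_n`. -/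
noncomputable def neg {n : ℕ} (π : SignedPerm n) : ℕ :=
  ((Finset.Icc 1 n).filter fun i => π.letter i < 0).card

/-- The flag-major index. -/
noncomputable def fmaj {n : ℕ} (π : SignedPerm n) : ℕ := (∑ i ∈ π.desSetB, 2 * i) + π.neg

end SignedPerm

/-- The type B `q`-Eulerian number `B_{n,ℓ}(q)`: the generating function of the flag-major index
over the signed permutations of `[n]` with exactly `ℓ` type B descents. -/
noncomputable def qEulerianB {R : Type*} [CommSemiring R] (q : R) (n l : ℕ) : R :=
  ∑ π ∈ (Finset.univ : Finset (SignedPerm n)).filter (fun π => π.desB = l), q ^ π.fmaj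

/-- The `q`-integer `[k]_q = 1 + q + ⋯ + q^(k-1)`, with `[0]_q = 0`. -/
def qInt {R : Type*} [CommSemiring R] (q : R) (k : ℕ) : R := ∑ i ∈ Finset.range k, q ^ i

/-- The `q`-factorial `[n]_q! = [1]_q [2]_q ⋯ [n]_q`. -/
def qFactorial {R : Type*} [CommSemiring R] (q : R) (n : ℕ) : R :=
  ∏ i ∈ Finset.Icc 1 n, qInt q i

/-- The `q`-binomial coefficient `[n]_q! / ([k]_q! [n-k]_q!)`, for `0 ≤ k ≤ n`. -/
noncomputable def qBinomial {K : Type*} [Field K] (q : K) (n k : ℕ) : K :=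
  qFactorial q n / (qFactorial q k * qFactorial q (n - k))

/-- The type B `q`-Stirling numbers of the second kind:
`S_B[n,k] = S_B[n-1,k-1] + [2k+1]_q S_B[n-1,k]` and `S_B[0,k] = δ_{0k}`,
with `S_B[n,-1] = 0`. -/
def qStirlingB {R : Type*} [CommSemiring R] (q : R) : ℕ → ℕ → R
  | 0, 0 => 1
  | 0, _ + 1 => 0
  | n + 1, 0 => qInt q 1 * qStirlingB q n 0
  | n + 1, k + 1 => qStirlingB q n k + qInt q (2 * (k + 1) + 1) * qStirlingB q n (k + 1)

/-!
Both sides satisfy the same recurrence in `n` and `k`, with the same initial values. Since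
`[2]_q [k]_{q²} = [2k]_q`, the left-hand side `a(n,k)` satisfies
`a(n+1,k) = [2k+1] a(n,k) + [2k] a(n,k-1)` by the definition of the `q`-Stirling numbers.

For the right-hand side one needs the recurrence
`B_{n+1,l} = [2l+1] B_{n,l} + q^(2l-1) [2(n+1-l)+1] B_{n,l-1}` (`qEulerianB_succ`). It comes from
inserting the letter `n+1` or `-(n+1)` into the words of the signed permutations of `[n]`. If such
a word has `d` descents, then the `2d + 1` insertions that keep the number of descents raise the
flag-major index by `0, …, 2d`, and the others by `2d+1, …, 2n+1`
(`SignedPerm.sum_insertions`, by induction on the word). That the words so obtained are all the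
words of signed permutations, each once, is `SignedPerm.map_word_univ`.

Substituting this recurrence and comparing the coefficients of `B_{n,l}` leaves an identity between
three Gaussian binomial coefficients (`gaussBinom_coeff_identity`), which follows from the
`q`-Pascal rule and the ratio of neighbouring coefficients (`gaussBinom_succ_mul`).
-/

/-! ### Descents and flag-major index of words -/

theorem qInt_succ {R : Type*} [CommSemiring R] (q : R) (k : ℕ) :
    qInt q (k + 1) = qInt q k + q ^ k := Finset.sum_range_succ _ _

theorem qInt_succ' {R : Type*} [CommSemiring R] (q : R) (k : ℕ) :
    qInt q (k + 1) = 1 + q * qInt q k := by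
  rw [qInt, Finset.sum_range_succ', qInt, Finset.mul_sum, add_comm]
  simp [pow_succ']

namespace SignedPerm

/-- The number of descents of the word `w` when it is preceded by the letter `a`; for `a = 0` this
is the number of type B descents. -/
def listDes : ℤ → List ℤ → ℕ
  | _, [] => 0
  | a, b :: w => (if b < a then 1 else 0) + listDes b w

/-- The flag-major index of the word `w` when it is preceded by the letter `a`. Prepending a letter
moves every descent of `w` one position to the right, which adds `2` for each of them; a descent
from `a` to the first letter of `w` is at position `0` and adds nothing. -/
def listFmaj : ℤ → List ℤ → ℕ
  | _, [] => 0
  | _, b :: w => listFmaj b w + 2 * listDes b w + if b < 0 then 1 else 0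

theorem listDes_le_length : ∀ (a : ℤ) (w : List ℤ), listDes a w ≤ w.length
  | _, [] => by simp [listDes]
  | a, b :: w => by
    have := listDes_le_length b w
    simp only [listDes, List.length_cons]
    split_ifs <;> omega

theorem listDes_map_range (g : ℕ → ℤ) (n : ℕ) :
    listDes (g 0) ((List.range n).map fun i => g (i + 1)) =
      ∑ i ∈ Finset.range n, if g (i + 1) < g i then 1 else 0 := by
  induction n generalizing g with
  | zero => simp [listDes]
  | succ n ih =>
    rw [List.range_succ_eq_map, Finset.sum_range_succ']
    simp only [List.map_cons, List.map_map, listDes]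
    rw [← ih fun i => g (i + 1), add_comm]
    rfl

theorem listFmaj_map_range (g : ℕ → ℤ) (n : ℕ) :
    listFmaj (g 0) ((List.range n).map fun i => g (i + 1)) =
      (∑ i ∈ Finset.range n, if g (i + 1) < g i then 2 * i else 0) +
        ∑ i ∈ Finset.range n, if g (i + 1) < 0 then 1 else 0 := by
  induction n generalizing g with
  | zero => simp [listFmaj]
  | succ n ih =>
    have h1 := ih fun i => g (i + 1)
    have h2 := listDes_map_range (fun i => g (i + 1)) n
    rw [List.range_succ_eq_map, Finset.sum_range_succ', Finset.sum_range_succ']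
    simp only [List.map_cons, List.map_map, listFmaj]
    simp only [Function.comp_def, Nat.succ_eq_add_one, zero_add] at h1 h2 ⊢
    rw [h1, h2, Finset.mul_sum]
    have h3 : ∀ i, (if g (i + 1 + 1) < g (i + 1) then 2 * (i + 1) else 0) =
        (if g (i + 1 + 1) < g (i + 1) then 2 * i else 0) +
          2 * (if g (i + 1 + 1) < g (i + 1) then 1 else 0) := by
      intro i; split_ifs <;> ring
    simp only [h3, Finset.sum_add_distrib, mul_zero, ite_self]
    ring

/-! ### Inserting a letter of largest absolute value -/

/-- Inserting `N` and `-N` in all possible ways into a word of length `m` with `d` descents and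
letters smaller than `N` in absolute value: the insertions that keep the number of descents raise
the flag-major index by `0, 1, …, 2d`, and those that create a descent raise it by
`2d + 1, …, 2m + 1`, each value occurring once. The arbitrary weight `f` of the number of descents
makes the induction on the word work: removing the first letter changes `f j` to
`f (ε + j) * q ^ (2 * j)`, where `ε` is `1` or `0`. -/
theorem sum_insertions {R : Type*} [CommSemiring R] (q : R) (N : ℤ) (w : List ℤ) (a : ℤ)
    (f : ℕ → R) (ha : |a| < N) (hw : ∀ b ∈ w, |b| < N) :
    ((w.permutations'Aux N).map fun u => f (listDes a u) * q ^ listFmaj a u).sum +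
        ((w.permutations'Aux (-N)).map fun u => f (listDes a u) * q ^ listFmaj a u).sum =
      q ^ listFmaj a w * (f (listDes a w) * qInt q (2 * listDes a w + 1) +
        f (listDes a w + 1) *
          (q ^ (2 * listDes a w + 1) * qInt q (2 * (w.length - listDes a w) + 1))) := by
  induction w generalizing a f with
  | nil =>
    have h1 : ¬ N < a := by have := abs_lt.1 ha; omega
    have h2 : -N < a := by have := abs_lt.1 ha; omega
    have h3 : ¬ N < 0 := by have := abs_nonneg a; omega
    have h4 : 0 < N := by have := abs_nonneg a; omega
    simp [List.permutations'Aux, listDes, listFmaj, h1, h2, h3, h4, qInt]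
  | cons b w ih =>
    obtain ⟨ha1, ha2⟩ := abs_lt.1 ha
    have hb := hw b (by simp)
    obtain ⟨hb1, hb2⟩ := abs_lt.1 hb
    have hN : 0 < N := by have := abs_nonneg a; omega
    have hd := listDes_le_length b w
    have key := ih b (fun j => f ((if b < a then 1 else 0) + j) * q ^ (2 * j)) hb
      fun x hx => hw x (by simp [hx])
    obtain ⟨m, hm⟩ := Nat.exists_eq_add_of_le hd
    have e1 : ∀ u : List ℤ, f (listDes a (b :: u)) * q ^ listFmaj a (b :: u) =
        (f ((if b < a then 1 else 0) + listDes b u) * q ^ (2 * listDes b u) *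
          q ^ listFmaj b u) * q ^ (if b < 0 then 1 else 0) := by
      intro u; simp only [listDes, listFmaj, pow_add]; ring
    simp only [List.permutations'Aux, List.map_cons, List.map_map, List.sum_cons,
      Function.comp_def]
    simp only [e1, List.sum_map_mul_right]
    have e2 : ∀ A B C D E : R, A + B * E + (C + D * E) = A + C + (B + D) * E := by
      intros; ring
    rw [e2, key]
    have g1 : ¬ N < a := by omega
    have g2 : b < N := hb2
    have g3 : ¬ N < 0 := by omega
    have g4 : -N < a := by omega
    have g5 : ¬ b < -N := by omega
    have g6 : -N < 0 := by omega
    -- The two words in which `±N` comes first both have a descent that involves it.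
    simp only [listDes, listFmaj, g1, g2, g3, g4, g5, g6, if_true, if_false, List.length_cons]
    rw [hm]
    generalize (if b < 0 then 1 else 0) = s
    generalize listDes b w = d
    generalize listFmaj b w = F
    split_ifs
    · have t1 : d + m + 1 - (1 + d) = m := by omega
      have t2 : d + m - d = m := by omega
      rw [t1, t2, show 2 * (1 + d) + 1 = (2 * d + 1) + 1 + 1 by ring, qInt_succ q (2 * d + 1 + 1),
        qInt_succ q (2 * d + 1)]
      ring_nf
    · have t1 : d + m + 1 - (0 + d) = m + 1 := by omega
      have t2 : d + m - d = m := by omega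
      rw [t1, t2, show 2 * (m + 1) + 1 = (2 * m + 1) + 1 + 1 by ring, qInt_succ' q (2 * m + 1 + 1),
        qInt_succ' q (2 * m + 1)]
      simp only [Nat.zero_add]
      ring_nf
end SignedPerm

/-! ### Signed permutations as words -/

namespace SignedPerm

/-- The word `π_1 π_2 ⋯ π_n` of a signed permutation `π`. -/
noncomputable def word {n : ℕ} (π : SignedPerm n) : List ℤ :=
  (List.range n).map fun i => π.letter (i + 1)

theorem mem_pmSet {n : ℕ} {i : ℤ} : i ∈ pmSet n ↔ i ≠ 0 ∧ i.natAbs ≤ n := by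
  simp only [pmSet, Finset.mem_erase, Finset.mem_Icc]
  omega

theorem letter_zero {n : ℕ} (π : SignedPerm n) : π.letter 0 = 0 := by
  simp [letter, mem_pmSet]

theorem letter_natAbs {n : ℕ} (π : SignedPerm n) (i : pmSet n) :
    π.letter (i : ℤ).natAbs = (i : ℤ).sign * (π.1 i : ℤ) := by
  obtain ⟨i, hi⟩ := i
  obtain ⟨h0, hn⟩ := mem_pmSet.1 hi
  have hm : (((i.natAbs : ℕ) : ℤ)) ∈ pmSet n := mem_pmSet.2 ⟨by omega, by omega⟩
  rw [letter, dif_pos hm]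
  rcases lt_or_gt_of_ne h0 with h | h
  · rw [π.2 ⟨i, hi⟩ ⟨_, hm⟩ (by simp only; omega), Int.sign_eq_neg_one_of_neg h]
    simp
  · have : (⟨((i.natAbs : ℕ) : ℤ), hm⟩ : pmSet n) = ⟨i, hi⟩ := Subtype.ext (by simp only; omega)
    rw [this, Int.sign_eq_one_of_pos h, one_mul]

theorem apply_eq_sign_mul_letter {n : ℕ} (π : SignedPerm n) (i : pmSet n) :
    (π.1 i : ℤ) = (i : ℤ).sign * π.letter (i : ℤ).natAbs := by
  have h := (mem_pmSet.1 i.2).1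
  rw [letter_natAbs, ← mul_assoc]
  rcases lt_or_gt_of_ne h with h | h
  · simp [Int.sign_eq_neg_one_of_neg h]
  · simp [Int.sign_eq_one_of_pos h]

theorem word_injective (n : ℕ) : Function.Injective (word (n := n)) := by
  intro π σ h
  have h1 : ∀ i < n, π.letter (i + 1) = σ.letter (i + 1) := by
    simpa [word] using h
  refine Subtype.ext (Equiv.ext fun i => Subtype.ext ?_)
  obtain ⟨h0, hn⟩ := mem_pmSet.1 i.2
  have h2 := h1 ((i : ℤ).natAbs - 1) (by omega)
  rw [Nat.sub_add_cancel (by omega)] at h2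
  rw [apply_eq_sign_mul_letter, apply_eq_sign_mul_letter, h2]

theorem natAbs_word_perm {n : ℕ} (π : SignedPerm n) :
    (π.word.map Int.natAbs).Perm (List.range' 1 n) := by
  have hmem : ∀ i < n, ∃ h : ((i + 1 : ℕ) : ℤ) ∈ pmSet n, π.letter (i + 1) = π.1 ⟨_, h⟩ :=
    fun i hi => ⟨mem_pmSet.2 ⟨by omega, by omega⟩, dif_pos _⟩
  refine (List.subperm_of_subset ?_ ?_).perm_of_length_le (by simp [word])
  · simp only [word, List.map_map]
    refine List.Nodup.map_on ?_ List.nodup_range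
    intro i hi j hj hij
    obtain ⟨hi', ei⟩ := hmem i (List.mem_range.1 hi)
    obtain ⟨hj', ej⟩ := hmem j (List.mem_range.1 hj)
    simp only [Function.comp_apply, ei, ej] at hij
    rcases Int.natAbs_eq_natAbs_iff.1 hij with h | h
    · have := congrArg Subtype.val (π.1.injective (Subtype.ext h))
      simp only at this; omega
    · -- equal absolute values with opposite signs would give `i + 1 = -(j + 1)`
      have hk : -((j + 1 : ℕ) : ℤ) ∈ pmSet n := by
        have := mem_pmSet.1 hj'
        exact mem_pmSet.2 ⟨by omega, by omega⟩
      rw [← π.2 ⟨_, hj'⟩ ⟨_, hk⟩ rfl] at h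
      have := congrArg Subtype.val (π.1.injective (Subtype.ext h))
      simp only at this; omega
  · intro x hx
    simp only [word, List.map_map, List.mem_map, List.mem_range, Function.comp_apply] at hx
    obtain ⟨i, hi, rfl⟩ := hx
    obtain ⟨hi', ei⟩ := hmem i hi
    have := mem_pmSet.1 (π.1 ⟨_, hi'⟩).2
    rw [ei, List.mem_range'_1]
    omega

theorem exists_word_eq {n : ℕ} {w : List ℤ}
    (hw : (w.map Int.natAbs).Perm (List.range' 1 n)) : ∃ π : SignedPerm n, π.word = w := by
  have hlen : w.length = n := by simpa using hw.length_eq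
  have hnd : (w.map Int.natAbs).Nodup := hw.nodup_iff.2 List.nodup_range'
  have hval : ∀ i (h : i < w.length), 1 ≤ w[i].natAbs ∧ w[i].natAbs ≤ n := by
    intro i h
    have : w[i].natAbs ∈ List.range' 1 n :=
      hw.mem_iff.1 (List.mem_map_of_mem (List.getElem_mem h))
    rw [List.mem_range'_1] at this
    omega
  have hidx : ∀ i : pmSet n, (i : ℤ).natAbs - 1 < w.length := by
    intro i
    have := mem_pmSet.1 i.2
    omega
  let F : pmSet n → pmSet n := fun i =>
    ⟨(i : ℤ).sign * w[(i : ℤ).natAbs - 1]'(hidx i), by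
      have h1 := hval _ (hidx i)
      have h2 : ((i : ℤ).sign * w[(i : ℤ).natAbs - 1]'(hidx i)).natAbs =
          (w[(i : ℤ).natAbs - 1]'(hidx i)).natAbs := by
        rw [Int.natAbs_mul, Int.natAbs_sign_of_ne_zero (mem_pmSet.1 i.2).1, one_mul]
      exact mem_pmSet.2 ⟨by omega, by omega⟩⟩
  have hF : ∀ i, (F i : ℤ) = (i : ℤ).sign * w[(i : ℤ).natAbs - 1]'(hidx i) := fun _ => rfl
  have hinj : Function.Injective F := by
    intro i j hij
    have hij' := congrArg Subtype.val hij
    rw [hF, hF] at hij'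
    obtain ⟨hi, -⟩ := mem_pmSet.1 i.2
    obtain ⟨hj, -⟩ := mem_pmSet.1 j.2
    have habs := congrArg Int.natAbs hij'
    rw [Int.natAbs_mul, Int.natAbs_mul, Int.natAbs_sign_of_ne_zero hi,
      Int.natAbs_sign_of_ne_zero hj, one_mul, one_mul] at habs
    have h1 : (i : ℤ).natAbs - 1 = (j : ℤ).natAbs - 1 :=
      (List.Nodup.getElem_inj_iff hnd (hi := by simpa using hidx i)
        (hj := by simpa using hidx j)).1 (by simpa using habs)
    have h0 := (hval _ (hidx j)).1
    simp only [h1] at hij'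
    have h2 : (i : ℤ).sign = (j : ℤ).sign := by
      refine mul_right_cancel₀ ?_ hij'
      intro h; rw [h] at h0; simp at h0
    refine Subtype.ext ?_
    rw [← Int.sign_mul_natAbs (i : ℤ), ← Int.sign_mul_natAbs (j : ℤ), h2,
      show (i : ℤ).natAbs = (j : ℤ).natAbs by omega]
  refine ⟨⟨Equiv.ofBijective F (Finite.injective_iff_bijective.1 hinj), ?_⟩, ?_⟩
  · intro i j hij
    simp only [Equiv.ofBijective_apply, hF, hij, Int.sign_neg, Int.natAbs_neg, neg_mul]
  · refine List.ext_getElem (by simp [word, hlen]) fun i h1 h2 => ?_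
    have hm : ((i + 1 : ℕ) : ℤ) ∈ pmSet n := mem_pmSet.2 ⟨by omega, by omega⟩
    simp only [word, List.getElem_map, List.getElem_range, letter, dif_pos hm,
      Equiv.ofBijective_apply, hF]
    rw [Int.sign_eq_one_of_pos (by omega), one_mul]
    congr 1

/-- The lists `[±n, …, ±2, ±1]`, one for each choice of signs. Their rearrangements are the words
of the signed permutations of `[n]`. -/
def signings : ℕ → List (List ℤ)
  | 0 => [[]]
  | n + 1 => (signings n).flatMap fun e => [((n : ℤ) + 1) :: e, (-((n : ℤ) + 1)) :: e]

theorem mem_signings {n : ℕ} {e : List ℤ} :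
    e ∈ signings n ↔ e.map Int.natAbs = (List.range' 1 n).reverse := by
  induction n generalizing e with
  | zero => simp [signings]
  | succ n ih =>
    rw [List.range'_1_concat, List.reverse_append]
    simp only [signings, List.mem_flatMap, List.mem_cons, List.not_mem_nil, or_false, ih,
      List.reverse_cons, List.reverse_nil, List.nil_append, List.cons_append]
    constructor
    · rintro ⟨e, he, rfl | rfl⟩
      · rw [List.map_cons, he]; congr 1; omega
      · rw [List.map_cons, he]; congr 1; omega
    · intro h
      cases e with
      | nil => simp at h
      | cons x e =>
        simp only [List.map_cons, List.cons.injEq] at h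
        refine ⟨e, h.2, ?_⟩
        simp only [List.cons.injEq, and_true]
        omega

theorem nodup_signings (n : ℕ) : (signings n).Nodup := by
  induction n with
  | zero => simp [signings]
  | succ n ih =>
    refine List.nodup_flatMap.2 ⟨fun e _ => ?_, ih.imp fun {e e'} hne => ?_⟩
    · simp only [List.nodup_cons, List.mem_cons, List.cons.injEq, and_true, List.not_mem_nil,
        or_false, not_false_eq_true, List.nodup_nil]
      omega
    · intro x hx hx'
      simp only [List.mem_cons, List.not_mem_nil, or_false] at hx hx'
      rcases hx with rfl | rfl <;> rcases hx' with h | h <;> simp_all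

theorem nodup_of_mem_signings {n : ℕ} {e : List ℤ} (he : e ∈ signings n) : e.Nodup :=
  List.Nodup.of_map Int.natAbs <| by
    rw [mem_signings.1 he, List.nodup_reverse]
    exact List.nodup_range'

theorem eq_of_perm_of_mem_signings {n : ℕ} {e e' : List ℤ} (he : e ∈ signings n)
    (he' : e' ∈ signings n) (h : e.Perm e') : e = e' := by
  have key : ∀ e ∈ signings n, e.Pairwise fun x y => y.natAbs < x.natAbs := by
    intro e he
    have : (e.map Int.natAbs).Pairwise (· > ·) := by
      rw [mem_signings.1 he, List.pairwise_reverse]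
      exact List.pairwise_lt_range'
    exact List.pairwise_map.1 this
  exact h.eq_of_pairwise (fun a b _ _ h1 h2 => absurd h1 (by omega)) (key e he) (key e' he')

theorem exists_mem_signings_perm {n : ℕ} {w : List ℤ}
    (hw : (w.map Int.natAbs).Perm (List.range' 1 n)) : ∃ e ∈ signings n, w.Perm e := by
  induction n generalizing w with
  | zero => exact ⟨[], by simp [signings], by simpa using hw⟩
  | succ n ih =>
    have hmem : n + 1 ∈ w.map Int.natAbs := hw.mem_iff.2 (by rw [List.mem_range'_1]; omega)
    obtain ⟨x, hx, hxn⟩ := List.mem_map.1 hmem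
    have hp := List.perm_cons_erase hx
    have h1 : ((w.erase x).map Int.natAbs).Perm (List.range' 1 n) := by
      rw [List.range'_1_concat] at hw
      have h2 := ((hp.map Int.natAbs).symm.trans hw).trans
        (List.perm_append_singleton (1 + n) (List.range' 1 n))
      rw [List.map_cons, hxn, add_comm n 1] at h2
      exact h2.cons_inv
    obtain ⟨e, he, hwe⟩ := ih h1
    refine ⟨x :: e, ?_, hp.trans (hwe.cons x)⟩
    rw [mem_signings] at he ⊢
    rw [List.map_cons, he, hxn, List.range'_1_concat, List.reverse_append, add_comm n 1]
    rfl

/-- Every rearrangement of a list in `signings n` is the word of exactly one signed permutation. -/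
theorem map_word_univ (n : ℕ) :
    (Finset.univ : Finset (SignedPerm n)).val.map word =
      (((signings n).flatMap List.permutations' : List (List ℤ)) : Multiset (List ℤ)) := by
  have hnd : ((signings n).flatMap List.permutations').Nodup := by
    refine List.nodup_flatMap.2 ⟨fun e he =>
      (List.permutations_perm_permutations' e).nodup_iff.1
        (List.nodup_permutations e (nodup_of_mem_signings he)),
      (nodup_signings n).imp_of_mem fun {e e'} he he' hne x hx hx' => hne ?_⟩
    rw [List.mem_permutations'] at hx hx'
    exact eq_of_perm_of_mem_signings he he' (hx.symm.trans hx')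
  refine (Multiset.Nodup.ext (Finset.univ.nodup.map (word_injective n))
    (Multiset.coe_nodup.2 hnd)).2 fun w => ?_
  simp only [Multiset.mem_map, Finset.mem_val, Finset.mem_univ, true_and, Multiset.mem_coe,
    List.mem_flatMap, List.mem_permutations']
  constructor
  · rintro ⟨π, rfl⟩
    exact exists_mem_signings_perm π.natAbs_word_perm
  · rintro ⟨e, he, hwe⟩
    refine exists_word_eq ((hwe.map _).trans ?_)
    rw [mem_signings.1 he]
    exact List.reverse_perm _

theorem desB_eq_listDes {n : ℕ} (π : SignedPerm n) : π.desB = listDes 0 π.word := by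
  rw [desB, desSetB, Finset.card_filter, ← listDes_map_range, letter_zero]
  rfl

theorem fmaj_eq_listFmaj {n : ℕ} (π : SignedPerm n) : π.fmaj = listFmaj 0 π.word := by
  have h := listFmaj_map_range π.letter n
  rw [letter_zero] at h
  rw [word, h, fmaj, desSetB, neg, Finset.sum_filter, Finset.card_filter,
    ← Finset.Ico_add_one_right_eq_Icc, Finset.sum_Ico_eq_sum_range]
  simp [add_comm]

theorem sum_eq_sum_signings {M : Type*} [AddCommMonoid M] (n : ℕ) (F : List ℤ → M) :
    ∑ π : SignedPerm n, F π.word =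
      ((signings n).map fun e => (e.permutations'.map F).sum).sum := by
  have h := congrArg (fun s => (Multiset.map F s).sum) (map_word_univ n)
  simp only [Multiset.map_map, Multiset.map_coe, Multiset.sum_coe] at h
  rw [List.map_flatMap, List.flatMap, List.sum_flatten, List.map_map] at h
  exact h

end SignedPerm

/-! ### The recurrence for the type B `q`-Eulerian numbers -/

open SignedPerm in
theorem qEulerianB_eq_sum_signings {R : Type*} [CommSemiring R] (q : R) (n l : ℕ) :
    qEulerianB q n l = ((signings n).map fun e => (e.permutations'.map fun w =>
      (if listDes 0 w = l then 1 else 0) * q ^ listFmaj 0 w).sum).sum := by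
  rw [← sum_eq_sum_signings n fun w => (if listDes 0 w = l then 1 else 0) * q ^ listFmaj 0 w,
    qEulerianB, Finset.sum_filter]
  simp [desB_eq_listDes, fmaj_eq_listFmaj]

open SignedPerm in
/-- The recurrence `B_{n+1,l} = [2l+1] B_{n,l} + q^(2l-1) [2(n+1-l)+1] B_{n,l-1}`, obtained by
deleting the letter `±(n+1)`. The truncated subtraction `n + 1 - l` matters only for `l > n + 1`,
where `B_{n,l-1} = 0`. -/
theorem qEulerianB_succ {R : Type*} [CommSemiring R] (q : R) (n l : ℕ) :
    qEulerianB q (n + 1) l = qInt q (2 * l + 1) * qEulerianB q n l +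
      if l = 0 then 0 else
        q ^ (2 * l - 1) * qInt q (2 * (n + 1 - l) + 1) * qEulerianB q n (l - 1) := by
  have key : ∀ e ∈ signings n, ∀ w ∈ e.permutations',
      (((w.permutations'Aux ((n : ℤ) + 1)).map fun u =>
        (if listDes 0 u = l then 1 else 0) * q ^ listFmaj 0 u).sum +
      ((w.permutations'Aux (-((n : ℤ) + 1))).map fun u =>
        (if listDes 0 u = l then 1 else 0) * q ^ listFmaj 0 u).sum) =
      qInt q (2 * l + 1) * ((if listDes 0 w = l then 1 else 0) * q ^ listFmaj 0 w) +
      (if l = 0 then 0 else q ^ (2 * l - 1) * qInt q (2 * (n + 1 - l) + 1)) *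
        ((if listDes 0 w = l - 1 then 1 else 0) * q ^ listFmaj 0 w) := by
    intro e he w hw
    rw [List.mem_permutations'] at hw
    have he' := mem_signings.1 he
    have hlen : w.length = n := by
      rw [hw.length_eq]
      simpa using congrArg List.length he'
    rw [sum_insertions q ((n : ℤ) + 1) w 0 (fun d => if d = l then 1 else 0)
      (by rw [abs_zero]; omega), hlen]
    · generalize listDes 0 w = d
      by_cases h1 : d = l
      · subst h1
        have : ¬ d = d - 1 ∨ d = 0 := by omega
        rcases this with h | h <;> simp [h, mul_comm]
      · by_cases h2 : d + 1 = l
        · subst h2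
          have : n + 1 - (d + 1) = n - d := by omega
          simp [this, show 2 * (d + 1) - 1 = 2 * d + 1 by omega]
          ring
        · have : l = 0 ∨ d ≠ l - 1 := by omega
          rcases this with rfl | h
          · simp [h1]
          · simp [h, h1, h2]
    · intro b hb
      have : b.natAbs ∈ (List.range' 1 n).reverse := by
        rw [← he']
        exact List.mem_map_of_mem (hw.mem_iff.1 hb)
      rw [List.mem_reverse, List.mem_range'_1] at this
      rw [abs_lt]; omega
  -- `permutations'` of a list inserts its head into the rearrangements of its tail.
  have hsplit : ∀ F : List ℤ → R,
      ((signings (n + 1)).map fun e => (e.permutations'.map F).sum).sum =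
      ((signings n).map fun e => (e.permutations'.map fun w =>
        ((w.permutations'Aux ((n : ℤ) + 1)).map F).sum +
          ((w.permutations'Aux (-((n : ℤ) + 1))).map F).sum).sum).sum := by
    intro F
    simp only [signings, List.flatMap, List.map_flatten, List.sum_flatten, List.map_map,
      Function.comp_def, List.map_cons, List.map_nil, List.sum_cons, List.sum_nil, add_zero,
      List.permutations', List.sum_map_add]
  rw [qEulerianB_eq_sum_signings, hsplit, qEulerianB_eq_sum_signings, qEulerianB_eq_sum_signings]
  have h2 : ∀ c : R, (if l = 0 then 0 else
        q ^ (2 * l - 1) * qInt q (2 * (n + 1 - l) + 1) * c) =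
      (if l = 0 then 0 else q ^ (2 * l - 1) * qInt q (2 * (n + 1 - l) + 1)) * c := by
    intro c; split_ifs <;> simp
  rw [h2]
  simp only [← List.sum_map_mul_left, ← List.sum_map_add]
  exact congrArg List.sum (List.map_congr_left fun e he =>
    congrArg List.sum (List.map_congr_left fun w hw => key e he w hw))

theorem qEulerianB_zero {R : Type*} [CommSemiring R] (q : R) (l : ℕ) :
    qEulerianB q 0 l = if l = 0 then 1 else 0 := by
  rw [qEulerianB_eq_sum_signings]
  simp [SignedPerm.signings, SignedPerm.listDes, SignedPerm.listFmaj, eq_comm]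

theorem qEulerianB_of_lt {R : Type*} [CommSemiring R] (q : R) {n l : ℕ} (h : n < l) :
    qEulerianB q n l = 0 := by
  rw [qEulerianB, Finset.sum_eq_zero]
  intro π hπ
  have h1 : π.desB ≤ n := by
    exact (Finset.card_filter_le _ _).trans_eq (Finset.card_range n)
  have := (Finset.mem_filter.1 hπ).2
  omega

/-! ### Gaussian binomial coefficients -/

section
variable {K : Type*} [Field K]

/-- The Gaussian binomial coefficient at `Q`, defined by the `q`-Pascal rule. It vanishes for `j > m`,
where the quotient of `q`-factorials `qBinomial` has a junk value. -/
def gaussBinom (Q : K) : ℕ → ℕ → K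
  | _, 0 => 1
  | 0, _ + 1 => 0
  | m + 1, j + 1 => gaussBinom Q m j + Q ^ (j + 1) * gaussBinom Q m (j + 1)

theorem gaussBinom_zero_right (Q : K) (m : ℕ) : gaussBinom Q m 0 = 1 := by
  cases m <;> rfl

theorem gaussBinom_of_lt (Q : K) {m j : ℕ} (h : m < j) : gaussBinom Q m j = 0 := by
  induction m generalizing j with
  | zero =>
    obtain ⟨j, rfl⟩ := Nat.exists_eq_succ_of_ne_zero (by omega : j ≠ 0)
    rfl
  | succ m ih =>
    obtain ⟨j, rfl⟩ := Nat.exists_eq_succ_of_ne_zero (by omega : j ≠ 0)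
    simp [gaussBinom, ih (show m < j by omega), ih (show m < j + 1 by omega)]

/-- The relation between neighbouring coefficients, multiplied by `Q ^ j` so that no exponent
`m - j` occurs and it holds for `j > m` too. -/
theorem gaussBinom_succ_mul (Q : K) (m j : ℕ) :
    gaussBinom Q m (j + 1) * ((Q ^ (j + 1) - 1) * Q ^ j) =
      (Q ^ m - Q ^ j) * gaussBinom Q m j := by
  induction m generalizing j with
  | zero =>
    cases j with
    | zero => simp [gaussBinom]
    | succ j => simp [gaussBinom]
  | succ m ih =>
    cases j with
    | zero =>
      have := ih 0
      simp only [gaussBinom, gaussBinom_zero_right] at this ⊢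
      linear_combination Q * this
    | succ j =>
      have h1 := ih j
      have h2 := ih (j + 1)
      simp only [gaussBinom]
      linear_combination Q * Q ^ (j + 1) * h2 + Q * h1

theorem gaussBinom_mul_qFactorial (Q : K) (m i : ℕ) :
    gaussBinom Q (m + i) m * (qFactorial Q m * qFactorial Q i) = qFactorial Q (m + i) := by
  have hf : ∀ r, qFactorial Q (r + 1) = qFactorial Q r * qInt Q (r + 1) := fun r =>
    Finset.prod_Icc_succ_top (by omega) _
  have h0 : qFactorial Q 0 = 1 := rfl
  have hi : ∀ a b, qInt Q (a + b) = qInt Q a + Q ^ a * qInt Q b := by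
    intro a b
    simp only [qInt, Finset.sum_range_add, Finset.mul_sum, pow_add]
  induction h : m + i generalizing m i with
  | zero =>
    obtain ⟨rfl, rfl⟩ : m = 0 ∧ i = 0 := by omega
    simp [gaussBinom, h0]
  | succ s ih =>
    rcases m with _ | m
    · obtain rfl : i = s + 1 := by omega
      simp [gaussBinom, h0]
    · rcases i with _ | i
      · obtain rfl : m = s := by omega
        have := ih m 0 rfl
        rw [gaussBinom, gaussBinom_of_lt Q (Nat.lt_succ_self m), hf]
        linear_combination qInt Q (m + 1) * this
      · have h1 := ih m (i + 1) (by omega)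
        have h2 := ih (m + 1) i (by omega)
        have hs : qInt Q (s + 1) = qInt Q (m + 1) + Q ^ (m + 1) * qInt Q (i + 1) := by
          rw [← hi, h]
        rw [hf i] at h1
        rw [hf m] at h2
        rw [gaussBinom, hf m, hf i, hf s, hs]
        linear_combination qInt Q (m + 1) * h1 + Q ^ (m + 1) * qInt Q (i + 1) * h2

theorem qBinomial_eq_gaussBinom {Q : K} (hQ : ∀ r, qInt Q (r + 1) ≠ 0) {m j : ℕ} (h : j ≤ m) :
    qBinomial Q m j = gaussBinom Q m j := by
  have hf : ∀ r, qFactorial Q r ≠ 0 := by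
    intro r
    refine Finset.prod_ne_zero_iff.2 fun i hi => ?_
    obtain ⟨i, rfl⟩ := Nat.exists_eq_succ_of_ne_zero (by simp at hi; omega : i ≠ 0)
    exact hQ i
  obtain ⟨i, rfl⟩ := Nat.exists_eq_add_of_le h
  rw [qBinomial, Nat.add_sub_cancel_left, div_eq_iff (mul_ne_zero (hf _) (hf _)),
    gaussBinom_mul_qFactorial]

theorem sub_one_mul_qInt (q : K) (m : ℕ) : (q - 1) * qInt q m = q ^ m - 1 := by
  rw [mul_comm]; exact geom_sum_mul q m

/-- What the recurrence of `eulerianSum` says about the coefficients of `B_{n,l}`, for `n = l + m`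
and `k = l + i`, up to a power of `q`. -/
theorem gaussBinom_coeff_identity {q : K} (hq : q ≠ 1) (l m i : ℕ) :
    q ^ (2 * i + 1) * (qInt q (2 * l + 1) * gaussBinom (q ^ 2) (m + 1) (i + 1)) +
        qInt q (2 * m + 1) * gaussBinom (q ^ 2) m i =
      q ^ (2 * i + 1) * (qInt q (2 * (l + i + 1) + 1) * gaussBinom (q ^ 2) m (i + 1)) +
        qInt q (2 * (l + i + 1)) * gaussBinom (q ^ 2) m i := by
  have h := gaussBinom_succ_mul (q ^ 2) m i
  have h1 := sub_one_mul_qInt q (2 * l + 1)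
  have h2 := sub_one_mul_qInt q (2 * m + 1)
  have h3 := sub_one_mul_qInt q (2 * (l + i + 1) + 1)
  have h4 := sub_one_mul_qInt q (2 * (l + i + 1))
  refine mul_left_cancel₀ (sub_ne_zero.2 hq) ?_
  rw [gaussBinom]
  generalize gaussBinom (q ^ 2) m i = A at *
  generalize gaussBinom (q ^ 2) m (i + 1) = B at *
  simp only [← pow_mul] at h ⊢
  linear_combination q ^ (2 * i + 1) * (A + q ^ (2 * (i + 1)) * B) * h1 + A * h2 -
    q ^ (2 * i + 1) * B * h3 - A * h4 - q * h

/-! ### The common recurrence of the two sides -/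

/-- The sum `∑ q^(k(k-2l)) B_{n,l} [n-l choose k-l]` over `l ≤ k`, taken at `q ^ 2` in the Gaussian
binomial coefficients. With `gaussBinom` it is meaningful for `k > n` too, where it is `0`. -/
noncomputable def eulerianSum (q : K) (n k : ℕ) : K :=
  ∑ l ∈ Finset.range (k + 1),
    q ^ ((k : ℤ) * ((k : ℤ) - 2 * (l : ℤ))) * qEulerianB q n l * gaussBinom (q ^ 2) (n - l) (k - l)

theorem eulerianSum_succ_succ {q : K} (hq0 : q ≠ 0) (hq1 : q ≠ 1) (n k : ℕ) :
    eulerianSum q (n + 1) (k + 1) =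
      qInt q (2 * (k + 1) + 1) * eulerianSum q n (k + 1) +
        qInt q (2 * (k + 1)) * eulerianSum q n k := by
  have e : ∀ c : ℕ → K, ∀ K', ∑ l ∈ Finset.range (K' + 1), c l * qEulerianB q (n + 1) l =
      ∑ l ∈ Finset.range (K' + 1), c l * (qInt q (2 * l + 1) * qEulerianB q n l) +
      ∑ l ∈ Finset.range K', c (l + 1) * (q ^ (2 * l + 1) * qInt q (2 * (n - l) + 1) *
        qEulerianB q n l) := by
    intro c K'
    simp only [qEulerianB_succ q n, mul_add, Finset.sum_add_distrib]
    congr 1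
    rw [Finset.sum_range_succ']
    simp [show ∀ l, 2 * (l + 1) - 1 = 2 * l + 1 by omega]
  simp only [eulerianSum, mul_right_comm _ (qEulerianB _ _ _)]
  rw [e fun l => q ^ (((k + 1 : ℕ) : ℤ) * (((k + 1 : ℕ) : ℤ) - 2 * (l : ℤ))) *
    gaussBinom (q ^ 2) (n + 1 - l) (k + 1 - l)]
  rw [Finset.sum_range_succ _ (k + 1), Finset.sum_range_succ _ (k + 1),
    mul_add (qInt q (2 * (k + 1) + 1)),
    Finset.mul_sum, Finset.mul_sum, add_right_comm, add_right_comm _ _ (∑ _ ∈ _, _),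
    ← Finset.sum_add_distrib, ← Finset.sum_add_distrib]
  congr 1
  · refine Finset.sum_congr rfl fun l hl => ?_
    rw [Finset.mem_range] at hl
    rcases lt_or_ge n l with hnl | hnl
    · simp [qEulerianB_of_lt q hnl]
    obtain ⟨i, rfl⟩ := Nat.exists_eq_add_of_le (Nat.lt_succ_iff.1 hl)
    obtain ⟨m, rfl⟩ := Nat.exists_eq_add_of_le hnl
    have key := gaussBinom_coeff_identity hq1 l m i
    rw [show l + m + 1 - l = m + 1 by omega, show l + i + 1 - l = i + 1 by omega,
      show l + m + 1 - (l + 1) = m by omega, show l + i + 1 - (l + 1) = i by omega,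
      show l + m - l = m by omega, show l + i - l = i by omega]
    -- a common power of `q` is split off: the exponents involved differ by `2 * i + 1`
    have p1 : q ^ (((l + i + 1 : ℕ) : ℤ) * (((l + i + 1 : ℕ) : ℤ) - 2 * (l : ℤ))) =
        q ^ (((l + i : ℕ) : ℤ) * (((l + i : ℕ) : ℤ) - 2 * (l : ℤ))) * q ^ (2 * i + 1) := by
      rw [← zpow_natCast q (2 * i + 1), ← zpow_add₀ hq0]
      congr 1; push_cast; ring
    have p2 : q ^ (((l + i + 1 : ℕ) : ℤ) * (((l + i + 1 : ℕ) : ℤ) - 2 * ((l + 1 : ℕ) : ℤ))) *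
        q ^ (2 * l + 1) =
        q ^ (((l + i : ℕ) : ℤ) * (((l + i : ℕ) : ℤ) - 2 * (l : ℤ))) := by
      rw [← zpow_natCast q (2 * l + 1), ← zpow_add₀ hq0]
      congr 1; push_cast; ring
    rw [p1]
    generalize q ^ (((l + i : ℕ) : ℤ) * (((l + i : ℕ) : ℤ) - 2 * (l : ℤ))) = P at *
    linear_combination P * qEulerianB q (l + m) l * key +
      gaussBinom (q ^ 2) m i * qInt q (2 * m + 1) * qEulerianB q (l + m) l * p2
  · -- the terms `l = k + 1`, which do not occur in `eulerianSum q n k`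
    simp only [Nat.sub_self, gaussBinom_zero_right]
    ring

theorem eulerianSum_zero_right (q : K) (n : ℕ) : eulerianSum q n 0 = 1 := by
  have h : qEulerianB q n 0 = 1 := by
    induction n with
    | zero => simp [qEulerianB_zero]
    | succ n ih => simp [qEulerianB_succ, ih, qInt]
  simp [eulerianSum, h, gaussBinom_zero_right]

theorem eulerianSum_zero_succ (q : K) (k : ℕ) : eulerianSum q 0 (k + 1) = 0 := by
  refine Finset.sum_eq_zero fun l _ => ?_
  rcases l with _ | l
  · simp [gaussBinom]
  · simp [qEulerianB_zero]

theorem qStirlingB_eq_eulerianSum {q : K} (hq0 : q ≠ 0) (hq1 : q ≠ 1) (n k : ℕ) :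
    qInt q 2 ^ k * qFactorial (q ^ 2) k * qStirlingB q n k = eulerianSum q n k := by
  have hf : ∀ r, qFactorial (q ^ 2) (r + 1) = qFactorial (q ^ 2) r * qInt (q ^ 2) (r + 1) :=
    fun r => Finset.prod_Icc_succ_top (by omega) _
  have h0 : qFactorial (q ^ 2) 0 = 1 := rfl
  have h2 : ∀ r, qInt q 2 * qInt (q ^ 2) r = qInt q (2 * r) := by
    intro r
    refine mul_left_cancel₀ (sub_ne_zero.2 hq1) ?_
    have h1 := sub_one_mul_qInt q 2
    have h3 := sub_one_mul_qInt (q ^ 2) r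
    have h4 := sub_one_mul_qInt q (2 * r)
    rw [← pow_mul] at h3
    linear_combination qInt (q ^ 2) r * h1 + h3 - h4
  induction n generalizing k with
  | zero =>
    cases k with
    | zero => simp [qStirlingB, h0, eulerianSum_zero_right]
    | succ k => simp [qStirlingB, eulerianSum_zero_succ]
  | succ n ih =>
    cases k with
    | zero =>
      have := ih 0
      rw [eulerianSum_zero_right] at this ⊢
      simpa [qStirlingB, qInt] using this
    | succ k =>
      rw [eulerianSum_succ_succ hq0 hq1, ← ih, ← ih, qStirlingB, hf, ← h2]
      ring

end

/-- The identity is one between rational functions in the indeterminate `q`. -/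
theorem theorem1p1 (n k : ℕ) (hk : k ≤ n) (q : RatFunc ℚ) (hq : q = RatFunc.X) :
    qInt q 2 ^ k * qFactorial (q ^ 2) k * qStirlingB q n k =
      ∑ l ∈ Finset.range (k + 1),
        q ^ ((k : ℤ) * ((k : ℤ) - 2 * (l : ℤ))) * qEulerianB q n l *
          qBinomial (q ^ 2) (n - l) (k - l) := by
  have hpow : ∀ r : ℕ, q ^ (r + 1) ≠ 1 := by
    intro r h
    rw [hq, ← RatFunc.algebraMap_X, ← map_pow, ← map_one (algebraMap (Polynomial ℚ) (RatFunc ℚ))]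
      at h
    have := congrArg Polynomial.natDegree (RatFunc.algebraMap_injective ℚ h)
    simp at this
  have hq0 : q ≠ 0 := hq ▸ RatFunc.X_ne_zero
  have hq1 : q ≠ 1 := by simpa using hpow 0
  rw [qStirlingB_eq_eulerianSum hq0 hq1]
  refine Finset.sum_congr rfl fun l hl => ?_
  rw [qBinomial_eq_gaussBinom _ (by omega)]
  -- a vanishing `[r+1]` at `q ^ 2` would make `q` a root of unity
  intro r h
  have h1 := sub_one_mul_qInt (q ^ 2) (r + 1)
  rw [h, mul_zero, ← pow_mul] at h1
  exact hpow (2 * r + 1) (by linear_combination -h1)
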